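/- Let $G=(V,E)$ be an oriented connected graph: $V$ is a finite non-empty set, $E\subset V\times V$, $(v,w)\in E$ implies $(w,v)\notin E$, and any two vertices are joined by a path when orientations are ignored. For $H\in\mathbb{R}^E$ let $(\operatorname{div}H)(v)=\sum_{w:(w,v)\in E}H((w,v))-\sum_{w:(v,w)\in E}H((v,w))$, and define the total variation of $u\in\mathbb{R}^V$ by $$J(u)=\sup\{\langle u,\operatorname{div}H\rangle : H\in\mathbb{R}^E,\ \|H\|_\infty\le 1\}=\sum_{(v,w)\in E}|u(w)-u(v)|,$$ with subdifferential $\partial J(u)=\{p\in\mathbb{R}^V:\langle h-u,p\rangle+J(u)\le J(h)\text{ for all }h\in\mathbb{R}^V\}$, where $\langle\cdot,\cdot\rangle$ is the standard scalar product on $\mathbb{R}^V$. Let $f\in\mathbb{R}^V$ and let $u:[0,\infty)\to\mathbb{R}^V$ be a solution of the TV flow with datum $f$, that is, $u$ is absolutely continuous on $[0,T]$ for every $T>0$, $u(0)=f$, and $u'(t)\in-\partial J(u(t))$ for almost every $t>0$. Then the following hold. 1. The mean is preserved: $\sum_{v\in V}u(t)(v)=\sum_{v\in V}f(v)$ for all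 $t\ge 0$. 2. The function $t\mapsto\|u(t)\|_2$ is nonincreasing on $[0,\infty)$. 3. The function $u$ is continuous and piecewise affine in $t$, with finitely many slope changes, and reaches the average of $f$ in finite time. More precisely, there are $M\ge 0$ and times $0=t_0<t_1<\dots<t_M$ such that the times $t>0$ at which $u'(t)$ does not exist are exactly $t_1,\dots,t_M$; for each $1\le k\le M$, $u$ is affine on $[t_{k-1},t_k]$ and so $u'$ is constant on $(t_{k-1},t_k)$; and $$u(t)(v)=\frac{1}{|V|}\sum_{w\in V}f(w)\quad\text{for all }t\ge t_M\text{ and }v\in V.$$ -/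

import Mathlib

open scoped RealInnerProductSpace

noncomputable section

/-- An oriented connected graph on the vertex set `V`: an asymmetric (hence loop-free) set of
directed edges such that the underlying undirected graph is connected (and `V` is nonempty). -/
structure OrientedGraph (V : Type*) where
  edges : Finset (V × V)
  asymm : ∀ v w : V, (v, w) ∈ edges → (w, v) ∉ edges
  connected : (SimpleGraph.fromRel fun v w : V => (v, w) ∈ edges).Connected

namespace OrientedGraph

variable {V : Type*} [Fintype V] (G : OrientedGraph V)

open Classical in
/-- The divergence of an edge function: the sum over the incoming edges minus the sum over the
outgoing edges. -/
def divergence (H : G.edges → ℝ) : EuclideanSpace ℝ V :=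
  WithLp.toLp 2 fun v =>
    (∑ e : G.edges with e.1.2 = v, H e) - ∑ e : G.edges with e.1.1 = v, H e

/-- The closed sup-norm ball of radius `α ≥ 0` in the space of edge functions. -/
def edgeBall (α : ℝ) : Set (G.edges → ℝ) := {H | ∀ e, |H e| ≤ α}

/-- The total variation `J`: the support function of the set of divergences of the unit ball. -/
def totalVariation (u : EuclideanSpace ℝ V) : ℝ :=
  sSup ((fun h => ⟪u, h⟫) '' (G.divergence '' G.edgeBall 1))

/-- The pairing of a vertex function with a divergence, as a sum over edges. -/
theorem inner_divergence (u : EuclideanSpace ℝ V) (H : G.edges → ℝ) :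
    ⟪u, G.divergence H⟫ = ∑ e : G.edges, (u e.1.2 - u e.1.1) * H e := by
  classical
  simp only [divergence, PiLp.inner_apply, RCLike.inner_apply, conj_trivial, sub_mul,
    Finset.sum_sub_distrib, Finset.sum_filter, Finset.sum_mul]
  rw [Finset.sum_comm, Finset.sum_comm (s := Finset.univ (α := V))]
  simp [ite_mul, mul_comm]

/-- The total variation is the sum of the absolute differences along the edges. -/
theorem totalVariation_eq_sum (u : EuclideanSpace ℝ V) :
    G.totalVariation u = ∑ e : G.edges, |u e.1.2 - u e.1.1| := by
  have hmax : IsGreatest ((fun h => ⟪u, h⟫) '' (G.divergence '' G.edgeBall 1))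
      (∑ e : G.edges, |u e.1.2 - u e.1.1|) := by
    constructor
    · refine ⟨_, ⟨fun e => SignType.sign (u e.1.2 - u e.1.1), ?_, rfl⟩, ?_⟩
      · intro e
        rcases lt_trichotomy (u e.1.2 - u e.1.1) 0 with h | h | h <;> simp [h]
      · simp only [inner_divergence, self_mul_sign]
    · rintro _ ⟨_, ⟨H, hH, rfl⟩, rfl⟩
      simp only [inner_divergence]
      refine Finset.sum_le_sum fun e _ => (le_abs_self _).trans ?_
      rw [abs_mul]
      exact mul_le_of_le_one_right (abs_nonneg _) (hH e)
  exact hmax.csSup_eq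

/-- The subdifferential of `J` at `u`. -/
def subdifferential (u : EuclideanSpace ℝ V) : Set (EuclideanSpace ℝ V) :=
  {p | ∀ h, ⟪h - u, p⟫ + G.totalVariation u ≤ G.totalVariation h}

/-- `u` (restricted to `[0, ∞)`) solves the TV flow with initial datum `f`: it is absolutely
continuous on every interval `[0, T]`, starts at `f`, and for almost every `t > 0` it is
differentiable at `t` with `u'(t) ∈ -∂J(u(t))`. Values of `u` at negative times play no role. -/
structure IsTVFlow (f : EuclideanSpace ℝ V) (u : ℝ → EuclideanSpace ℝ V) : Prop where
  absolutelyContinuous : ∀ T : ℝ, 0 < T → AbsolutelyContinuousOnInterval u 0 T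
  initial : u 0 = f
  inclusion : ∀ᵐ t : ℝ, 0 < t → ∃ p ∈ G.subdifferential (u t), HasDerivAt u (-p) t


end OrientedGraph

end

/-! `J` is a sum of absolute values, hence polyhedral: `∂J(u)` depends only on the signs of the edge
differences of `u`, so its least-norm element `d(u)` takes finitely many values
(`finite_range_minSubgradient`). Starting at `u a`, `d = d(u a)` remains a subgradient along the ray
of velocity `-d` for a short time. That ray is then itself a flow, and monotonicity of `∂J` forces
`u` to follow it (`eq_ray`). `J` falls at rate `‖d‖²` along the ray, so a nonzero `d` lasts only
finitely long. At the last time it is still a subgradient but no longer minimal, so the least norm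
strictly drops (`exists_maximal_ray`). Finitely many norms give finitely many pieces, ending with `d
= 0`, where connectedness makes `u` constant. -/

/-! ### Absolutely continuous functions. -/

namespace AbsolutelyContinuousOnInterval

open MeasureTheory Set

theorem lipschitz_comp {X Y : Type*} [PseudoMetricSpace X] [PseudoMetricSpace Y] {K : NNReal}
    {φ : X → Y} (hφ : LipschitzWith K φ) {f : ℝ → X} {a b : ℝ}
    (hf : AbsolutelyContinuousOnInterval f a b) :
    AbsolutelyContinuousOnInterval (fun x => φ (f x)) a b := by
  refine squeeze_zero (fun E => Finset.sum_nonneg fun i _ => dist_nonneg) (fun E => ?_)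
    (by simpa using Filter.Tendsto.const_mul (K : ℝ) hf)
  rw [Finset.mul_sum]
  exact Finset.sum_le_sum fun i _ => hφ.dist_le_mul _ _

theorem norm_sq {E : Type*} [SeminormedAddCommGroup E] {f : ℝ → E} {a b : ℝ}
    (hf : AbsolutelyContinuousOnInterval f a b) :
    AbsolutelyContinuousOnInterval (fun x => ‖f x‖ ^ 2) a b := by
  have h := hf.lipschitz_comp lipschitzWith_one_norm
  simpa only [sq] using h.fun_mul h

/-- An absolutely continuous function with almost everywhere nonpositive derivative does not
increase. -/
theorem le_of_ae_hasDerivAt_nonpos {g : ℝ → ℝ} {a b : ℝ} (hab : a ≤ b)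
    (hg : AbsolutelyContinuousOnInterval g a b)
    (hd : ∀ᵐ t : ℝ, t ∈ Ioc a b → ∃ c ≤ 0, HasDerivAt g c t) : g b ≤ g a := by
  have h := hg.integral_deriv_eq_sub
  have h' : ∫ x in a..b, deriv g x ≤ 0 := by
    rw [intervalIntegral.integral_of_le hab]
    refine integral_nonpos_of_ae ((ae_restrict_iff' measurableSet_Ioc).2 ?_)
    filter_upwards [hd] with t ht hm
    obtain ⟨c, hc, hgc⟩ := ht hm
    simpa [hgc.deriv] using hc
  linarith

end AbsolutelyContinuousOnInterval

/-- Along a ray, the absolute value is eventually linear. -/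
theorem exists_abs_le_one_eventually_mul_eq_abs (a b : ℝ) :
    ∃ c : ℝ, |c| ≤ 1 ∧ ∀ᶠ t in nhdsWithin (0 : ℝ) (Set.Ici 0), (a + t * b) * c = |a + t * b| := by
  have hcont : Filter.Tendsto (fun t : ℝ => a + t * b) (nhdsWithin 0 (Set.Ici 0)) (nhds a) := by
    have : Continuous fun t : ℝ => a + t * b := by fun_prop
    simpa using (this.tendsto 0).mono_left nhdsWithin_le_nhds
  rcases lt_trichotomy a 0 with ha | rfl | ha
  · refine ⟨-1, by simp, ?_⟩
    filter_upwards [hcont.eventually_lt_const ha] with t ht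
    rw [abs_of_neg ht]; ring
  · refine ⟨SignType.sign b, by rcases lt_trichotomy b 0 with h | h | h <;> simp [h], ?_⟩
    filter_upwards [self_mem_nhdsWithin] with t ht
    rw [zero_add, mul_assoc, self_mul_sign, abs_mul, abs_of_nonneg (Set.mem_Ici.1 ht)]
  · refine ⟨1, by simp, ?_⟩
    filter_upwards [hcont.eventually_const_lt ha] with t ht
    rw [abs_of_pos ht]; ring

theorem eventually_abs_sub_mul_eq {a b : ℝ} (h : SignType.sign a = SignType.sign b) :
    ∀ᶠ t in nhdsWithin (0 : ℝ) (Set.Ioi 0), |a - t * b| = |a| - t * |b| := by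
  have hcont : Filter.Tendsto (fun t : ℝ => a - t * b) (nhdsWithin 0 (Set.Ioi 0)) (nhds a) := by
    have : Continuous fun t : ℝ => a - t * b := by fun_prop
    simpa using (this.tendsto 0).mono_left nhdsWithin_le_nhds
  rcases lt_trichotomy a 0 with ha | rfl | ha
  · have hb : b < 0 := by rwa [sign_neg ha, eq_comm, sign_eq_neg_one_iff] at h
    filter_upwards [hcont.eventually_lt_const ha] with t ht
    rw [abs_of_neg ht, abs_of_neg ha, abs_of_neg hb]; ring
  · obtain rfl : b = 0 := by rwa [sign_zero, eq_comm, sign_eq_zero_iff] at h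
    simp
  · have hb : 0 < b := by rwa [sign_pos ha, eq_comm, sign_eq_one_iff] at h
    filter_upwards [hcont.eventually_const_lt ha] with t ht
    rw [abs_of_pos ht, abs_of_pos ha, abs_of_pos hb]

/-! ### The subdifferential and its element of least norm. -/

namespace OrientedGraph

variable {V : Type*} [Fintype V] (G : OrientedGraph V)

theorem totalVariation_nonneg (u : EuclideanSpace ℝ V) : 0 ≤ G.totalVariation u := by
  rw [totalVariation_eq_sum]
  positivity

theorem totalVariation_smul {c : ℝ} (hc : 0 ≤ c) (u : EuclideanSpace ℝ V) :
    G.totalVariation (c • u) = c * G.totalVariation u := by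
  simp only [totalVariation_eq_sum, Finset.mul_sum, PiLp.smul_apply, smul_eq_mul, ← mul_sub,
    abs_mul, abs_of_nonneg hc]

@[fun_prop]
theorem continuous_totalVariation : Continuous G.totalVariation := by
  simp only [funext G.totalVariation_eq_sum]
  fun_prop

/-- Positive homogeneity: testing the definition at `0` and `2u` forces the equality. -/
theorem mem_subdifferential_iff {u p : EuclideanSpace ℝ V} :
    p ∈ G.subdifferential u ↔
      (∀ h, ⟪h, p⟫ ≤ G.totalVariation h) ∧ ⟪u, p⟫ = G.totalVariation u := by
  constructor
  · intro hp
    have h0 := hp ((0 : ℝ) • u)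
    have h2 := hp ((2 : ℝ) • u)
    rw [G.totalVariation_smul (by norm_num), inner_sub_left, inner_smul_left] at h0 h2
    simp only [conj_trivial] at h0 h2
    have heq : ⟪u, p⟫ = G.totalVariation u := by linarith
    refine ⟨fun h => ?_, heq⟩
    have := hp h
    rw [inner_sub_left] at this
    linarith
  · rintro ⟨hp, heq⟩ h
    rw [inner_sub_left]
    linarith [hp h]

theorem divergence_mem_subdifferential {u : EuclideanSpace ℝ V} {H : G.edges → ℝ}
    (hH : ∀ e, |H e| ≤ 1) (hu : ∀ e, (u e.1.2 - u e.1.1) * H e = |u e.1.2 - u e.1.1|) :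
    G.divergence H ∈ G.subdifferential u := by
  refine G.mem_subdifferential_iff.2 ⟨fun h => ?_, ?_⟩
  · rw [inner_divergence, totalVariation_eq_sum]
    refine Finset.sum_le_sum fun e _ => (le_abs_self _).trans ?_
    rw [abs_mul]
    exact mul_le_of_le_one_right (abs_nonneg _) (hH e)
  · rw [inner_divergence, totalVariation_eq_sum]
    exact Finset.sum_congr rfl fun e _ => hu e

/-- The subdifferentials at points of a short ray have a common element. -/
theorem exists_eventually_mem_subdifferential (u h : EuclideanSpace ℝ V) :
    ∃ q, ∀ᶠ t in nhdsWithin (0 : ℝ) (Set.Ici 0), q ∈ G.subdifferential (u + t • h) := by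
  choose H hH hev using fun e : G.edges =>
    exists_abs_le_one_eventually_mul_eq_abs (u e.1.2 - u e.1.1) (h e.1.2 - h e.1.1)
  refine ⟨G.divergence H, ?_⟩
  filter_upwards [Filter.eventually_all.2 hev] with t ht
  refine G.divergence_mem_subdifferential hH fun e => ?_
  convert! ht e using 2 <;> simp <;> ring_nf

theorem subdifferential_nonempty (u : EuclideanSpace ℝ V) : (G.subdifferential u).Nonempty := by
  obtain ⟨q, hq⟩ := G.exists_eventually_mem_subdifferential u 0
  obtain ⟨t, ht⟩ := hq.exists
  exact ⟨q, by simpa using ht⟩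

theorem isClosed_subdifferential (u : EuclideanSpace ℝ V) : IsClosed (G.subdifferential u) := by
  simp only [subdifferential, Set.ofPred_forall]
  exact isClosed_iInter fun h => isClosed_le (by fun_prop) (by fun_prop)

theorem convex_subdifferential (u : EuclideanSpace ℝ V) : Convex ℝ (G.subdifferential u) := by
  intro p hp q hq a b ha hb hab h
  have h1 := mul_le_mul_of_nonneg_left (hp h) ha
  have h2 := mul_le_mul_of_nonneg_left (hq h) hb
  rw [inner_add_right, inner_smul_right, inner_smul_right]
  obtain rfl : b = 1 - a := by linarith
  linarith

theorem exists_minimal_subgradient (u : EuclideanSpace ℝ V) :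
    ∃ p ∈ G.subdifferential u, ∀ q ∈ G.subdifferential u, ‖p‖ ^ 2 ≤ ⟪p, q⟫ := by
  obtain ⟨p, hp, hmin⟩ := exists_norm_eq_iInf_of_complete_convex (G.subdifferential_nonempty u)
    (G.isClosed_subdifferential u).isComplete (G.convex_subdifferential u) 0
  refine ⟨p, hp, fun q hq => ?_⟩
  -- Variational inequality for the projection of `0` onto a closed convex set.
  have := (norm_eq_iInf_iff_real_inner_le_zero (G.convex_subdifferential u) hp).1 hmin q hq
  rw [zero_sub, inner_neg_left, inner_sub_right, real_inner_self_eq_norm_sq] at this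
  linarith

/-- The element of least norm of the subdifferential at `u`. -/
noncomputable def minSubgradient (u : EuclideanSpace ℝ V) : EuclideanSpace ℝ V :=
  (G.exists_minimal_subgradient u).choose

theorem minSubgradient_mem (u : EuclideanSpace ℝ V) :
    G.minSubgradient u ∈ G.subdifferential u :=
  (G.exists_minimal_subgradient u).choose_spec.1

theorem norm_sq_minSubgradient_le_inner {u q : EuclideanSpace ℝ V}
    (hq : q ∈ G.subdifferential u) : ‖G.minSubgradient u‖ ^ 2 ≤ ⟪G.minSubgradient u, q⟫ :=
  (G.exists_minimal_subgradient u).choose_spec.2 q hq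

theorem norm_sub_minSubgradient_sq_le {u q : EuclideanSpace ℝ V}
    (hq : q ∈ G.subdifferential u) :
    ‖q - G.minSubgradient u‖ ^ 2 ≤ ‖q‖ ^ 2 - ‖G.minSubgradient u‖ ^ 2 := by
  have := G.norm_sq_minSubgradient_le_inner hq
  rw [norm_sub_sq_real, real_inner_comm]
  linarith

theorem norm_minSubgradient_lt {u q : EuclideanSpace ℝ V}
    (hq : q ∈ G.subdifferential u) (hne : G.minSubgradient u ≠ q) :
    ‖G.minSubgradient u‖ < ‖q‖ := by
  have h := G.norm_sub_minSubgradient_sq_le hq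
  have h' : 0 < ‖q - G.minSubgradient u‖ := norm_pos_iff.2 (sub_ne_zero.2 hne.symm)
  exact lt_of_pow_lt_pow_left₀ 2 (norm_nonneg _) (by nlinarith)

/-- Moving against the minimal subgradient keeps it a subgradient for a short time. -/
theorem eventually_minSubgradient_mem (u : EuclideanSpace ℝ V) :
    ∀ᶠ t in nhdsWithin (0 : ℝ) (Set.Ici 0),
      G.minSubgradient u ∈ G.subdifferential (u - t • G.minSubgradient u) := by
  set d := G.minSubgradient u
  obtain ⟨q, hq⟩ := G.exists_eventually_mem_subdifferential u (-d)
  have hq0 : q ∈ G.subdifferential u := by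
    simpa using hq.self_of_nhdsWithin (Set.mem_Ici.2 le_rfl)
  have hd := G.mem_subdifferential_iff.1 (G.minSubgradient_mem u)
  have hdq : ‖d‖ ^ 2 ≤ ⟪d, q⟫ := G.norm_sq_minSubgradient_le_inner hq0
  filter_upwards [hq, self_mem_nhdsWithin] with t ht ht0
  rw [smul_neg, ← sub_eq_add_neg] at ht
  -- With the common subgradient `q`, `J(u - td) = J(u) - t⟪d, q⟫ ≤ J(u) - t‖d‖² = ⟪u - td, d⟫`.
  refine G.mem_subdifferential_iff.2 ⟨hd.1, le_antisymm (hd.1 _) ?_⟩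
  rw [← (G.mem_subdifferential_iff.1 ht).2, inner_sub_left, inner_sub_left, hd.2,
    ← (G.mem_subdifferential_iff.1 hq0).2, inner_smul_left, inner_smul_left,
    real_inner_self_eq_norm_sq]
  have := mul_le_mul_of_nonneg_left hdq (Set.mem_Ici.1 ht0)
  simp only [conj_trivial]
  linarith

/-- For small `t > 0` equal signs give `J(u - tw) = J(u) - tJ(w)`; testing `p` there yields `J(w) ≤
⟪w, p⟫`. -/
theorem subdifferential_subset_of_sign_eq {u w : EuclideanSpace ℝ V}
    (hs : ∀ e : G.edges,
      SignType.sign (u e.1.2 - u e.1.1) = SignType.sign (w e.1.2 - w e.1.1)) :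
    G.subdifferential u ⊆ G.subdifferential w := by
  intro p hp
  obtain ⟨hp, hpu⟩ := G.mem_subdifferential_iff.1 hp
  refine G.mem_subdifferential_iff.2 ⟨hp, le_antisymm (hp w) ?_⟩
  obtain ⟨t, ht, ht0⟩ := ((Filter.eventually_all.2 fun e : G.edges =>
    eventually_abs_sub_mul_eq (hs e)).and self_mem_nhdsWithin).exists
  have hJ : G.totalVariation (u - t • w) = G.totalVariation u - t * G.totalVariation w := by
    simp only [totalVariation_eq_sum, Finset.mul_sum, ← Finset.sum_sub_distrib]
    refine Finset.sum_congr rfl fun e _ => ?_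
    rw [← ht e]
    simp only [PiLp.sub_apply, PiLp.smul_apply, smul_eq_mul]
    ring_nf
  have h := hp (u - t • w)
  rw [hJ, inner_sub_left, hpu, inner_smul_left, conj_trivial] at h
  exact le_of_mul_le_mul_left (by linarith) (Set.mem_Ioi.1 ht0)

theorem finite_range_minSubgradient : (Set.range G.minSubgradient).Finite := by
  let σ : EuclideanSpace ℝ V → (G.edges → SignType) :=
    fun u e => SignType.sign (u e.1.2 - u e.1.1)
  have hσ : ∀ u w, σ u = σ w → G.minSubgradient u = G.minSubgradient w := by
    intro u w h
    have h1 : G.minSubgradient u ∈ G.subdifferential w :=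
      G.subdifferential_subset_of_sign_eq (fun e => congrFun h e) (G.minSubgradient_mem u)
    have h2 : G.minSubgradient w ∈ G.subdifferential u :=
      G.subdifferential_subset_of_sign_eq (fun e => (congrFun h e).symm) (G.minSubgradient_mem w)
    by_contra hne
    exact (G.norm_minSubgradient_lt h2 hne).not_gt (G.norm_minSubgradient_lt h1 (Ne.symm hne))
  -- The map factors through the finite set of sign patterns.
  have : G.minSubgradient = fun u => Function.extend σ G.minSubgradient 0 (σ u) := by
    funext u
    exact (Function.FactorsThrough.extend_apply (fun a b h => hσ a b h) 0 u).symm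
  rw [this]
  exact (Set.finite_range (Function.extend σ G.minSubgradient 0)).subset
    (Set.range_comp_subset_range σ (Function.extend σ G.minSubgradient 0))

theorem eq_of_zero_mem_subdifferential {u : EuclideanSpace ℝ V}
    (h : (0 : EuclideanSpace ℝ V) ∈ G.subdifferential u) (v w : V) : u v = u w := by
  have h0 : G.totalVariation u = 0 := by
    simpa using (G.mem_subdifferential_iff.1 h).2.symm
  rw [totalVariation_eq_sum, Finset.sum_eq_zero_iff_of_nonneg fun e _ => abs_nonneg _] at h0
  have hedge : ∀ a b, (a, b) ∈ G.edges → u a = u b := fun a b hab => by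
    have := h0 ⟨(a, b), hab⟩ (Finset.mem_univ _)
    linarith [abs_eq_zero.1 this]
  obtain ⟨p⟩ := G.connected.preconnected v w
  induction p with
  | nil => rfl
  | cons hadj _ ih =>
    rw [← ih]
    rcases (SimpleGraph.fromRel_adj _ _ _).1 hadj with ⟨_, h | h⟩
    · exact hedge _ _ h
    · exact (hedge _ _ h).symm

/-- `J` vanishes on constants of either sign. -/
theorem sum_eq_zero_of_mem_subdifferential {u p : EuclideanSpace ℝ V}
    (hp : p ∈ G.subdifferential u) : ∑ v, p v = 0 := by
  have hle := (G.mem_subdifferential_iff.1 hp).1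
  have h (c : ℝ) : c * ∑ v, p v ≤ 0 := by
    have := hle (WithLp.toLp 2 fun _ => c)
    rw [totalVariation_eq_sum] at this
    simpa [PiLp.inner_apply, Finset.sum_mul, mul_comm, Finset.mul_sum] using this
  linarith [h 1, h (-1)]

/-- The subdifferential is monotone. -/
theorem inner_sub_sub_nonneg {u w p q : EuclideanSpace ℝ V}
    (hp : p ∈ G.subdifferential u) (hq : q ∈ G.subdifferential w) : 0 ≤ ⟪u - w, p - q⟫ := by
  have h1 := hp w
  have h2 := hq u
  rw [← neg_sub u w, inner_neg_left] at h1
  rw [inner_sub_right]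
  linarith

end OrientedGraph

/-! ### Evolution along the flow. -/

namespace OrientedGraph

variable {V : Type*} [Fintype V] {G : OrientedGraph V}

open MeasureTheory Set

namespace IsTVFlow

variable {f : EuclideanSpace ℝ V} {u : ℝ → EuclideanSpace ℝ V}

theorem absolutelyContinuousOnInterval (hu : G.IsTVFlow f u) {a b : ℝ} (ha : 0 ≤ a)
    (hab : a ≤ b) : AbsolutelyContinuousOnInterval u a b := by
  refine (hu.absolutelyContinuous (b + 1) (by linarith)).mono ?_
  rw [uIcc_of_le hab, uIcc_of_le (by linarith)]
  exact Icc_subset_Icc ha (by linarith)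

theorem sum_eq (hu : G.IsTVFlow f u) {t : ℝ} (ht : 0 ≤ t) : ∑ v, u t v = ∑ v, f v := by
  have key (c : ℝ) : c * ∑ v, u t v ≤ c * ∑ v, u 0 v := by
    let φ : EuclideanSpace ℝ V →L[ℝ] ℝ := c • ∑ v, EuclideanSpace.proj v
    have hφ (x : EuclideanSpace ℝ V) : φ x = c * ∑ v, x v := by simp [φ]
    have h := ((hu.absolutelyContinuousOnInterval le_rfl ht).lipschitz_comp
      φ.lipschitz).le_of_ae_hasDerivAt_nonpos ht (by
        filter_upwards [hu.inclusion] with s hs hmem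
        obtain ⟨p, hp, hd⟩ := hs hmem.1
        refine ⟨φ (-p), ?_, φ.hasFDerivAt.comp_hasDerivAt s hd⟩
        rw [map_neg, hφ, G.sum_eq_zero_of_mem_subdifferential hp]
        simp)
    simpa only [hφ] using h
  rw [← hu.initial]
  linarith [key 1, key (-1)]

theorem antitoneOn_norm (hu : G.IsTVFlow f u) : AntitoneOn (fun t => ‖u t‖) (Ici 0) := by
  intro a ha b _ hab
  have h := (hu.absolutelyContinuousOnInterval ha hab).norm_sq.le_of_ae_hasDerivAt_nonpos hab (by
    filter_upwards [hu.inclusion] with s hs hmem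
    obtain ⟨p, hp, hd⟩ := hs (lt_of_le_of_lt ha hmem.1)
    refine ⟨_, ?_, hd.norm_sq⟩
    -- The derivative of `‖u‖²` is `-2⟪u, p⟫ = -2J(u)`.
    rw [inner_neg_right, (G.mem_subdifferential_iff.1 hp).2]
    linarith [G.totalVariation_nonneg (u s)])
  exact le_of_sq_le_sq h (norm_nonneg _)

/-- A flow follows a ray as long as the direction of the ray is a subgradient. -/
theorem eq_ray (hu : G.IsTVFlow f u) {a b : ℝ} (ha : 0 ≤ a) (hab : a ≤ b)
    {d : EuclideanSpace ℝ V}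
    (hd : ∀ t ∈ Ioc a b, d ∈ G.subdifferential (u a - (t - a) • d)) :
    u b = u a - (b - a) • d := by
  have hray (t : ℝ) : HasDerivAt (fun t => u a - (t - a) • d) (-d) t := by
    simpa using (((hasDerivAt_id t).sub_const a).smul_const d).const_sub (u a)
  have hac : AbsolutelyContinuousOnInterval (fun t => u a - (t - a) • d) a b :=
    ContDiffOn.absolutelyContinuousOnInterval (by fun_prop)
  -- The squared distance between flow and ray starts at `0` and cannot grow.
  have h := ((hu.absolutelyContinuousOnInterval ha hab).sub
    hac).norm_sq.le_of_ae_hasDerivAt_nonpos hab (by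
      filter_upwards [hu.inclusion] with s hs hmem
      obtain ⟨p, hp, hp'⟩ := hs (lt_of_le_of_lt ha hmem.1)
      refine ⟨_, ?_, (hp'.sub (hray s)).norm_sq⟩
      have := G.inner_sub_sub_nonneg hp (hd s hmem)
      have he : -p - -d = -(p - d) := by abel
      rw [he, inner_neg_right]
      simpa using this)
  simp only [Pi.sub_apply, sub_self, zero_smul, sub_zero, norm_zero] at h
  have h0 : ‖u b - (u a - (b - a) • d)‖ = 0 := by nlinarith [norm_nonneg (u b - (u a - (b - a) • d))]
  exact sub_eq_zero.1 (norm_eq_zero.1 h0)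

theorem exists_eq_ray (hu : G.IsTVFlow f u) {a : ℝ} (ha : 0 ≤ a) :
    ∃ b > a, ∀ t ∈ Icc a b,
      G.minSubgradient (u a) ∈ G.subdifferential (u a - (t - a) • G.minSubgradient (u a)) ∧
      u t = u a - (t - a) • G.minSubgradient (u a) := by
  obtain ⟨ε, hε, h⟩ := (nhdsGE_basis_Icc (a := (0 : ℝ))).mem_iff.1 (G.eventually_minSubgradient_mem (u a))
  refine ⟨a + ε, by simpa using hε, fun t ht => ⟨h ⟨?_, ?_⟩, hu.eq_ray ha ht.1 fun s hs => h ⟨?_, ?_⟩⟩⟩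
  all_goals first | linarith [ht.1, ht.2] | linarith [hs.1, hs.2, ht.2]

theorem hasDerivWithinAt_Ici (hu : G.IsTVFlow f u) {a : ℝ} (ha : 0 ≤ a) :
    HasDerivWithinAt u (-G.minSubgradient (u a)) (Ici a) a := by
  obtain ⟨b, hb, h⟩ := hu.exists_eq_ray ha
  have hray : HasDerivAt (fun t => u a - (t - a) • G.minSubgradient (u a))
      (-G.minSubgradient (u a)) a := by
    simpa using (((hasDerivAt_id a).sub_const a).smul_const (G.minSubgradient (u a))).const_sub (u a)
  refine hray.hasDerivWithinAt.congr_of_eventuallyEq ?_ (by simp)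
  filter_upwards [Icc_mem_nhdsGE hb] with t ht using (h t ht).2

/-- Either the flow is stationary from time `a` on, or it follows its minimal subgradient up to
a time at which the subdifferential contains a shorter vector. -/
theorem exists_maximal_ray (hu : G.IsTVFlow f u) {a : ℝ} (ha : 0 ≤ a)
    (hne : G.minSubgradient (u a) ≠ 0) :
    ∃ b > a, (∀ t ∈ Icc a b, u t = u a - (t - a) • G.minSubgradient (u a)) ∧
      ‖G.minSubgradient (u b)‖ < ‖G.minSubgradient (u a)‖ := by
  set d := G.minSubgradient (u a) with hd
  let A : Set ℝ := {b | a < b ∧ ∀ t ∈ Icc a b,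
    d ∈ G.subdifferential (u a - (t - a) • d) ∧ u t = u a - (t - a) • d}
  have hA : A.Nonempty := hu.exists_eq_ray ha
  have hbdd : BddAbove A := by
    -- From `0 ≤ J(u a - (b - a)d) = J(u a) - (b - a)‖d‖²`.
    refine ⟨a + G.totalVariation (u a) / ‖d‖ ^ 2, fun b ⟨hab, h⟩ => ?_⟩
    have h1 := (G.mem_subdifferential_iff.1 (h b ⟨hab.le, le_rfl⟩).1).2
    have h2 := (G.mem_subdifferential_iff.1 (G.minSubgradient_mem (u a))).2
    rw [← hd] at h2
    rw [inner_sub_left, h2, inner_smul_left, conj_trivial, real_inner_self_eq_norm_sq] at h1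
    have h3 := G.totalVariation_nonneg (u a - (b - a) • d)
    have : b - a ≤ G.totalVariation (u a) / ‖d‖ ^ 2 := by
      rw [le_div_iff₀ (by positivity)]
      linarith
    linarith
  obtain ⟨b₀, hb₀⟩ := hA
  have hab : a < sSup A := hb₀.1.trans_le (le_csSup hbdd hb₀)
  set T := sSup A
  have hIco (t : ℝ) (ht : t ∈ Ico a T) :
      d ∈ G.subdifferential (u a - (t - a) • d) ∧ u t = u a - (t - a) • d := by
    obtain ⟨b, hb, htb⟩ := exists_lt_of_lt_csSup ⟨b₀, hb₀⟩ ht.2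
    exact hb.2 t ⟨ht.1, htb.le⟩
  have hcl : Icc a T ⊆ closure (Ico a T) := (closure_Ico hab.ne).ge
  have hsub (t : ℝ) (ht : t ∈ Icc a T) : d ∈ G.subdifferential (u a - (t - a) • d) := by
    have : IsClosed {t : ℝ | d ∈ G.subdifferential (u a - (t - a) • d)} := by
      change IsClosed {t : ℝ | ∀ h, _}
      rw [ofPred_forall]
      exact isClosed_iInter fun h => isClosed_le (by fun_prop) (by fun_prop)
    exact closure_minimal (fun t ht => (hIco t ht).1) this (hcl ht)
  have heq (t : ℝ) (ht : t ∈ Icc a T) : u t = u a - (t - a) • d :=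
    hu.eq_ray ha ht.1 fun s hs => hsub s ⟨hs.1.le, hs.2.trans ht.2⟩
  refine ⟨T, hab, heq, ?_⟩
  have hT : d ∈ G.subdifferential (u T) := by
    rw [heq T ⟨hab.le, le_rfl⟩]
    exact hsub T ⟨hab.le, le_rfl⟩
  -- Were `d` still minimal at `T`, the ray could be prolonged beyond the supremum.
  refine G.norm_minSubgradient_lt hT fun hTd => ?_
  obtain ⟨b, hTb, hb⟩ := hu.exists_eq_ray (ha.trans hab.le)
  rw [hTd] at hb
  have hbA : b ∈ A := by
    refine ⟨hab.trans hTb, fun t ht => ?_⟩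
    rcases le_total t T with htT | htT
    · exact ⟨hsub t ⟨ht.1, htT⟩, heq t ⟨ht.1, htT⟩⟩
    · have he : u T - (t - T) • d = u a - (t - a) • d := by
        rw [heq T ⟨hab.le, le_rfl⟩]
        module
      rw [← he]
      exact hb t ⟨htT, ht.2⟩
  exact (le_csSup hbdd hbA).not_gt hTb

theorem eq_of_minSubgradient_eq_zero (hu : G.IsTVFlow f u) {a : ℝ} (ha : 0 ≤ a)
    (h0 : G.minSubgradient (u a) = 0) {t : ℝ} (hat : a ≤ t) : u t = u a := by
  have hmem := G.minSubgradient_mem (u a)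
  rw [h0] at hmem
  simpa using hu.eq_ray ha hat (d := 0) (by simpa using fun _ _ _ => hmem)

/-- Well-founded induction on the least norm, which has finitely many values; the starting time
varies so that the induction can restart at the end of each ray. -/
theorem exists_breakpoints (hu : G.IsTVFlow f u) {a : ℝ} (ha : 0 ≤ a) :
    ∃ (M : ℕ) (t : Fin (M + 1) → ℝ), t 0 = a ∧ StrictMono t ∧
      {s : ℝ | a < s ∧ ¬ DifferentiableAt ℝ u s} = range (fun k : Fin M => t k.succ) ∧
      (∀ k : Fin M, ∃ c : EuclideanSpace ℝ V,
        (∀ s ∈ Icc (t k.castSucc) (t k.succ),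
          u s = u (t k.castSucc) + (s - t k.castSucc) • c) ∧
        ∀ s ∈ Ioo (t k.castSucc) (t k.succ), HasDerivAt u c s) ∧
      ∀ s : ℝ, t (Fin.last M) ≤ s → ∀ v w, u s v = u s w := by
  have hwf : WellFounded fun x y => ‖G.minSubgradient x‖ < ‖G.minSubgradient y‖ := by
    have h : (range fun x => ‖G.minSubgradient x‖).Finite := by
      rw [range_comp' norm G.minSubgradient]
      exact G.finite_range_minSubgradient.image _
    exact wellFoundedOn_range.1 (h.wellFoundedOn (r := (· < ·)))
  induction hx : u a using hwf.induction generalizing a with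
  | _ x ih =>
    subst hx
    by_cases h0 : G.minSubgradient (u a) = 0
    · have hconst {s : ℝ} (hs : a ≤ s) : u s = u a := hu.eq_of_minSubgradient_eq_zero ha h0 hs
      refine ⟨0, fun _ => a, rfl, fun i j h => absurd h (by omega), ?_, fun k => k.elim0, ?_⟩
      · rw [range_eq_empty]
        refine eq_empty_of_forall_notMem fun s hs => hs.2 ?_
        refine (differentiableAt_const (u a)).congr_of_eventuallyEq ?_
        filter_upwards [lt_mem_nhds hs.1] with r hr using hconst hr.le
      · intro s hs
        have hmem := G.minSubgradient_mem (u a)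
        rw [h0, ← hconst hs] at hmem
        exact G.eq_of_zero_mem_subdifferential hmem
    obtain ⟨b, hab, hray, hlt⟩ := hu.exists_maximal_ray ha h0
    set d := G.minSubgradient (u a)
    have hderiv (s : ℝ) : HasDerivAt (fun t => u a - (t - a) • d) (-d) s := by
      simpa using (((hasDerivAt_id s).sub_const a).smul_const d).const_sub (u a)
    have hIoo (s : ℝ) (hs : s ∈ Ioo a b) : HasDerivAt u (-d) s := by
      refine (hderiv s).congr_of_eventuallyEq ?_
      filter_upwards [Ioo_mem_nhds hs.1 hs.2] with r hr using hray r (Ioo_subset_Icc_self hr)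
    -- The left derivative is `-d`, the right one is minus a strictly shorter vector.
    have hb : ¬ DifferentiableAt ℝ u b := by
      intro hdiff
      have hl : HasDerivWithinAt u (-d) (Iic b) b := by
        refine (hderiv b).hasDerivWithinAt.congr_of_eventuallyEq ?_ (hray b ⟨hab.le, le_rfl⟩)
        filter_upwards [Icc_mem_nhdsLE hab] with r hr using hray r hr
      have h1 := (uniqueDiffWithinAt_Iic b).eq_deriv _ hdiff.hasDerivAt.hasDerivWithinAt hl
      have h2 := (uniqueDiffWithinAt_Ici b).eq_deriv _ hdiff.hasDerivAt.hasDerivWithinAt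
        (hu.hasDerivWithinAt_Ici (ha.trans hab.le))
      have h3 := neg_injective (h1.symm.trans h2)
      rw [← h3] at hlt
      exact lt_irrefl _ hlt
    obtain ⟨M, t, ht0, hmono, hset, haff, hlast⟩ := ih (u b) hlt (ha.trans hab.le) rfl
    refine ⟨M + 1, Fin.cons a t, rfl, ?_, ?_, ?_, ?_⟩
    · rw [Fin.strictMono_iff_lt_succ]
      intro k
      refine Fin.cases ?_ (fun k => ?_) k
      · simpa [ht0] using hab
      · rw [← Fin.succ_castSucc, Fin.cons_succ, Fin.cons_succ]
        exact hmono k.castSucc_lt_succ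
    · ext s
      simp only [Fin.cons_succ, mem_range, mem_ofPred_eq]
      have hs := Set.ext_iff.1 hset s
      simp only [mem_range, mem_ofPred_eq] at hs
      rw [Fin.exists_fin_succ, ht0, ← hs]
      constructor
      · rintro ⟨has, hns⟩
        rcases lt_trichotomy s b with h | h | h
        · exact absurd (hIoo s ⟨has, h⟩).differentiableAt hns
        · exact Or.inl h.symm
        · exact Or.inr ⟨h, hns⟩
      · rintro (rfl | ⟨h, hns⟩)
        · exact ⟨hab, hb⟩
        · exact ⟨hab.trans h, hns⟩
    · intro k
      refine Fin.cases ?_ (fun k => ?_) k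
      · refine ⟨-d, ?_, ?_⟩
        · intro s hs
          have : s ∈ Icc a b := by simpa [ht0] using hs
          simpa [sub_eq_add_neg] using hray s this
        · intro s hs
          exact hIoo s (by simpa [ht0] using hs)
      · simpa [← Fin.succ_castSucc] using haff k
    · rw [← Fin.succ_last, Fin.cons_succ]
      exact hlast

end IsTVFlow

end OrientedGraph

theorem proposition4p2 {V : Type*} [Fintype V] (G : OrientedGraph V)
    (f : EuclideanSpace ℝ V) (u : ℝ → EuclideanSpace ℝ V) (hu : G.IsTVFlow f u) :
    (∀ t : ℝ, 0 ≤ t → ∑ v, u t v = ∑ v, f v) ∧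
    AntitoneOn (fun t : ℝ => ‖u t‖) (Set.Ici 0) ∧
    -- the breakpoints `0 = t 0 < t 1 < ⋯ < t M`
    ∃ (M : ℕ) (t : Fin (M + 1) → ℝ), t 0 = 0 ∧ StrictMono t ∧
      -- the positive times at which `u` is not differentiable are exactly `t 1, …, t M`
      {s : ℝ | 0 < s ∧ ¬ DifferentiableAt ℝ u s} = Set.range (fun k : Fin M => t k.succ) ∧
      -- between consecutive breakpoints `u` is affine, with constant derivative
      (∀ k : Fin M, ∃ c : EuclideanSpace ℝ V,
        (∀ s ∈ Set.Icc (t k.castSucc) (t k.succ),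
          u s = u (t k.castSucc) + (s - t k.castSucc) • c) ∧
        ∀ s ∈ Set.Ioo (t k.castSucc) (t k.succ), HasDerivAt u c s) ∧
      -- from the last breakpoint on, `u` is the constant average of `f`
      (∀ s : ℝ, t (Fin.last M) ≤ s → ∀ v, u s v = (∑ w, f w) / Fintype.card V) := by
  obtain ⟨M, t, ht0, hmono, hset, haff, hlast⟩ := hu.exists_breakpoints le_rfl
  refine ⟨fun t ht => hu.sum_eq ht, hu.antitoneOn_norm, M, t, ht0, hmono, hset, haff,
    fun s hs v => ?_⟩
  have hs0 : 0 ≤ s := ht0.ge.trans ((hmono.monotone (Fin.zero_le _)).trans hs)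
  have hcard : (Fintype.card V : ℝ) ≠ 0 := by
    have : Nonempty V := ⟨v⟩
    exact_mod_cast Fintype.card_ne_zero
  rw [eq_div_iff hcard, ← hu.sum_eq hs0, Finset.sum_congr rfl fun w _ => hlast s hs w v]
  simp [mul_comm]
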